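/- Let $k\ge 4$, let $X=\{1,\dots,k\}$, and let $X^\omega$ be the set of infinite words $x_1x_2x_3\ldots$ over $X$. For $i\neq j$ in $X$ let $a_{(ij)}:X^\omega\to X^\omega$ be the transformation that replaces the first occurrence of a letter from $\{i,j\}$ in a word by the other letter of $\{i,j\}$ and leaves all other letters unchanged (a word without the letters $i,j$ is fixed); these are the transformations defined by the nontrivial states of the Hanoi Towers automaton $\mathcal A_{(k)}$ on $k$ pegs. Let $G_{(k)}$ be the group generated by all $a_{(ij)}$. For $w\in X^\omega$ the orbital Schreier graph $\Gamma_w$ has the orbit $G_{(k)}(w)$ as its vertex set, and two distinct vertices $u,v$ are adjacent if $a_{(ij)}(u)=v$ for some $i\neq j$. For a vertex $v$ of $\Gamma_w$ let $\gamma_{w,v}(n)$ be the number of vertices in the closed ball of radius $n$ centered at $v$ in $\Gamma_w$. For functions $f,g$ on the positive integers write $f\prec g$ if there is a positive integer $C$ with $f(n)\le g(Cn)$ for all $n\ge 1$. A connected locally finite graph has intermediate growth if each of its growth functions $\gamma$ satisfies $p\prec\gamma$ and $\gamma\not\prec p$ for every polynomial function $p$, and $\gamma\prec a^n$ and $a^n\not\prec\gamma$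 for every $a>1$. Logarithms are to base $2$, with the convention $\log 0=\log 1=1$. **Theorem.** Let $k\ge 4$. For every $w\in X^\omega$ the graph $\Gamma_w$ is connected and locally finite and has intermediate growth. Moreover, there are constants $C,c>0$, depending only on $k$, such that for every $w\in X^\omega$ and every vertex $v$ of $\Gamma_w$ $$\gamma_{w,v}(n)\le k^{C(\log n)^{k-2}}\ \text{ for all } n\ge 0,\qquad \gamma_{w,v}(n)\ge k^{c(\log n)^{k-2}}\ \text{ for all } n\ge 1 .$$ -/

import Mathlib

namespace AutomatonGrowth

/-- An invertible automaton with state set `S` over the alphabet `X`: `next s x` is the state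
reached from `s` along the arrow whose left label is `x`, and `out s` is the permutation of the
alphabet given by the output function at `s` (the arrow is labelled `x | out s x`). -/
structure InvertibleAutomaton (S X : Type*) where
  next : S → X → S
  out : S → Equiv.Perm X

namespace InvertibleAutomaton

variable {S X : Type*}

/-- The state reached from `s` after reading the first `n` letters of the infinite word `w`. -/
def stateAt (A : InvertibleAutomaton S X) (s : S) (w : ℕ → X) : ℕ → S
  | 0 => s
  | n + 1 => A.next (A.stateAt s w n) (w n)

/-- The image of the infinite word `w` under the state `s`. -/
def act (A : InvertibleAutomaton S X) (s : S) (w : ℕ → X) : ℕ → X :=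
  fun n => A.out (A.stateAt s w n) (w n)

/-- The inverse automaton: every label `x | y` is replaced by `y | x`. -/
def inverse (A : InvertibleAutomaton S X) : InvertibleAutomaton S X where
  next s y := A.next s ((A.out s).symm y)
  out s := (A.out s).symm

theorem stateAt_inverse_act (A : InvertibleAutomaton S X) (s : S) (w : ℕ → X) (n : ℕ) :
    A.inverse.stateAt s (A.act s w) n = A.stateAt s w n := by
  induction n with
  | zero => rfl
  | succ n ih =>
    rw [stateAt, stateAt, ih]
    exact congrArg _ ((A.out _).symm_apply_apply _)

theorem stateAt_act_inverse (A : InvertibleAutomaton S X) (s : S) (w : ℕ → X) (n : ℕ) :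
    A.stateAt s (A.inverse.act s w) n = A.inverse.stateAt s w n := by
  induction n with
  | zero => rfl
  | succ n ih =>
    rw [stateAt, stateAt, ih]
    rfl

/-- The transformation of the space of infinite words defined by the state `s`. -/
def toPerm (A : InvertibleAutomaton S X) (s : S) : Equiv.Perm (ℕ → X) where
  toFun := A.act s
  invFun := A.inverse.act s
  left_inv w := by
    funext n
    change A.inverse.out (A.inverse.stateAt s (A.act s w) n) (A.act s w n) = w n
    rw [stateAt_inverse_act]
    simp [inverse, act]
  right_inv w := by
    funext n
    change A.out (A.stateAt s (A.inverse.act s w) n) (A.inverse.act s w n) = w n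
    rw [stateAt_act_inverse]
    simp [inverse, act]

end InvertibleAutomaton

/-- The orbital (simplicial) Schreier graph of the group generated by a set `T` of permutations
of `Y`: the vertices are the points of the orbit of `y`, and two distinct vertices `u`, `v` are
adjacent if `t u = v` for some `t ∈ T ∪ T⁻¹`. -/
def orbitalSchreierGraph {Y : Type*} (T : Set (Equiv.Perm Y)) (y : Y) :
    SimpleGraph (MulAction.orbit (Subgroup.closure T) y) where
  Adj u v := u ≠ v ∧ ∃ t : Equiv.Perm Y, (t ∈ T ∨ t⁻¹ ∈ T) ∧ t (u : Y) = (v : Y)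
  symm := ⟨by
    rintro u v ⟨hne, t, ht, htu⟩
    refine ⟨hne.symm, t⁻¹, ?_, ?_⟩
    · rw [inv_inv]
      exact ht.symm
    · rw [← htu]
      exact t.symm_apply_apply _⟩
  loopless := ⟨fun _ h => h.1 rfl⟩

/-- The orbital Schreier graph, at the infinite word `w`, of the group generated by all states of
the automaton, with respect to the states as generators. -/
def InvertibleAutomaton.schreierGraph {S X : Type*} (A : InvertibleAutomaton S X) (w : ℕ → X) :
    SimpleGraph (MulAction.orbit (Subgroup.closure (Set.range A.toPerm)) w) :=
  orbitalSchreierGraph (Set.range A.toPerm) w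

/-- The growth function of a graph with respect to a vertex `v`: the number of vertices in the
closed ball of radius `n` centered at `v`. The distance `edist` is `⊤` between vertices that no
walk joins. -/
noncomputable def growthFunction {V : Type*} (G : SimpleGraph V) (v : V) (n : ℕ) : ℕ :=
  Set.ncard {u : V | G.edist v u ≤ (n : ℕ∞)}

/-- The order `f ≺ g` on growth functions: `f n ≤ g (C n)` for some constant `C` and all `n`
(here `n` ranges over the positive integers). -/
def GrowthLE (f g : ℕ → ℝ) : Prop :=
  ∃ C : ℕ, 0 < C ∧ ∀ n : ℕ, 1 ≤ n → f n ≤ g (C * n)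

/-- `f ≺ g`, and `f` and `g` are not equivalent. -/
def GrowthLT (f g : ℕ → ℝ) : Prop :=
  GrowthLE f g ∧ ¬ GrowthLE g f

/-- Growth strictly greater than that of every polynomial function. -/
def IsSuperpolynomial (f : ℕ → ℝ) : Prop :=
  ∀ p : Polynomial ℝ, GrowthLT (fun n => p.eval (n : ℝ)) f

/-- Growth strictly less than that of the exponential functions `a ^ n`, `a > 1`. -/
def IsSubexponential (f : ℕ → ℝ) : Prop :=
  ∀ a : ℝ, 1 < a → GrowthLT f (fun n => a ^ n)

/-- A connected locally finite graph has intermediate growth if its growth function (with respect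
to any vertex) is superpolynomial and subexponential. -/
structure HasIntermediateGrowth {V : Type*} (G : SimpleGraph V) : Prop where
  connected : G.Connected
  locallyFinite : ∀ v : V, (G.neighborSet v).Finite
  superpolynomial : ∀ v : V, IsSuperpolynomial (fun n => (growthFunction G v n : ℝ))
  subexponential : ∀ v : V, IsSubexponential (fun n => (growthFunction G v n : ℝ))

/-- The binary logarithm of a natural number, with the convention `log 0 = log 1 = 1`. -/
noncomputable def binLog (n : ℕ) : ℝ :=
  if n ≤ 1 then 1 else Real.logb 2 (n : ℝ)

/-- The states of the Hanoi Towers automaton on `k` pegs: the trivial state, and one state for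
every transposition `(i j)` of the set of pegs. -/
inductive HanoiState (k : ℕ) : Type
  | e : HanoiState k
  | a (i j : Fin k) (h : i < j) : HanoiState k

/-- The Hanoi Towers automaton on `k` pegs. The state `a_(ij)` has two arrows to the trivial
state, labelled `i | j` and `j | i`, and a loop labelled `x | x` for every other letter `x`. -/
def hanoiAutomaton (k : ℕ) : InvertibleAutomaton (HanoiState k) (Fin k) where
  next
    | .e, _ => .e
    | .a i j h, x => if x = i ∨ x = j then .e else .a i j h
  out
    | .e => 1
    | .a i j _ => Equiv.swap i j

end AutomatonGrowth

namespace AutomatonGrowth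

/-! Read a word as a position of the Hanoi game with infinitely many disks: letter `n` is the peg of
disk `n`, and disk `0` is the smallest. Then `a_(ij)` moves the smallest disk on the pegs `i`, `j`
to the other of the two, so `Γ_w` is the graph of positions and balls count positions reachable in
`n` moves (`hanoiGraph_edist_le_iff`). Put `k = j + 2`.

Upper bound: if fewer than `2 ^ x` moves are made, only `O(x ^ j)` disks move
(`card_le_of_moveCount_lt`). The induction is of Frame–Stewart type: either the small disks all move
twice, which doubles the number of moves, or one of them rests on a peg while larger disks move,
which costs those a peg. A disk moves only if all smaller disks on its initial peg move too, so a
reachable position is determined by the places of the disks of rank `O(x ^ j)` on each of the `k`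
pegs. With `x` about `log n` this leaves `k ^ O((log n) ^ j)` positions.

Lower bound: `5 ^ x` moves suffice to gather the `gatherSize j x` smallest disks on one peg
(`gather`), and this size grows like `x ^ j`. Moves are reversible, so all arrangements of these
disks are within `2 * 5 ^ x` moves of any position.

Since `j ≥ 2` for `k ≥ 4`, the exponent `(log n) ^ j` exceeds every multiple of `log n` and stays
below every multiple of `n`; this is intermediate growth. -/

/-! ### The Hanoi game on infinitely many disks -/

/-- `v` arises from `u` by at most one legal move of the Hanoi game: a disk may leave or enter a
peg only if no smaller disk lies there. -/
def HanoiStep {α : Type*} (u v : ℕ → α) : Prop :=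
  ∀ s, u s ≠ v s → ∀ e, e ≠ s → u e = v e ∧ (e < s → u e ≠ u s ∧ u e ≠ v s)

theorem HanoiStep.refl {α : Type*} (u : ℕ → α) : HanoiStep u u :=
  fun _ h => absurd rfl h

theorem HanoiStep.symm {α : Type*} {u v : ℕ → α} (h : HanoiStep u v) : HanoiStep v u := by
  intro s hs e he
  obtain ⟨h1, h2⟩ := h s hs.symm e he
  refine ⟨h1.symm, fun hlt => ?_⟩
  rw [← h1]
  exact (h2 hlt).symm

/-- Reachability in exactly `n` (possibly idle) steps of the Hanoi game. -/
inductive HanoiReach {α : Type*} : ℕ → (ℕ → α) → (ℕ → α) → Prop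
  | zero (u : ℕ → α) : HanoiReach 0 u u
  | succ {n : ℕ} {u v w : ℕ → α} (h : HanoiReach n u v) (h' : HanoiStep v w) :
      HanoiReach (n + 1) u w

namespace HanoiReach

variable {α : Type*} {u v w : ℕ → α} {m n : ℕ}

theorem refl (n : ℕ) (u : ℕ → α) : HanoiReach n u u := by
  induction n with
  | zero => exact .zero u
  | succ n ih => exact ih.succ (.refl u)

theorem trans (h : HanoiReach m u v) (h' : HanoiReach n v w) : HanoiReach (m + n) u w := by
  induction h' with
  | zero => exact h
  | succ _ hs ih => exact (ih h).succ hs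

theorem mono (h : HanoiReach m u v) (hmn : m ≤ n) : HanoiReach n u v := by
  obtain ⟨l, rfl⟩ := Nat.exists_eq_add_of_le hmn
  exact h.trans (refl l v)

theorem of_step (h : HanoiStep u v) : HanoiReach 1 u v :=
  (zero u).succ h

theorem symm (h : HanoiReach n u v) : HanoiReach n v u := by
  induction h with
  | zero => exact .zero _
  | succ _ hs ih =>
    rw [add_comm]
    exact (of_step hs.symm).trans ih

theorem exists_path (h : HanoiReach n u v) :
    ∃ c : ℕ → ℕ → α, c 0 = u ∧ c n = v ∧ ∀ t < n, HanoiStep (c t) (c (t + 1)) := by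
  induction h with
  | zero => exact ⟨fun _ => _, rfl, rfl, fun t ht => absurd ht (Nat.not_lt_zero t)⟩
  | @succ n u v w _ hs ih =>
    obtain ⟨c, h0, hn, hc⟩ := ih
    refine ⟨fun t => if t ≤ n then c t else w, by simpa using h0, by simp, fun t ht => ?_⟩
    rcases Nat.lt_succ_iff_lt_or_eq.1 ht with h | rfl
    · simpa [h.le, Nat.succ_le_of_lt h] using hc t h
    · simpa [hn] using hs

end HanoiReach

/-! ### Few moves displace few disks -/

/-- A finite set of natural numbers has initial segments of every possible cardinality. -/
theorem exists_initial_segment (S : Finset ℕ) (n : ℕ) (hn : n ≤ S.card) :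
    ∃ A ⊆ S, A.card = n ∧ ∀ a ∈ A, ∀ b ∈ S, b ∉ A → a < b := by
  induction n with
  | zero => exact ⟨∅, by simp, by simp, by simp⟩
  | succ n ih =>
    obtain ⟨A, hAS, hA, hlt⟩ := ih (by omega)
    have hne : (S \ A).Nonempty := by
      rw [← Finset.card_pos, Finset.card_sdiff_of_subset hAS]
      omega
    have hmem := Finset.mem_sdiff.1 ((S \ A).min'_mem hne)
    refine ⟨insert ((S \ A).min' hne) A, Finset.insert_subset hmem.1 hAS, ?_, ?_⟩
    · rw [Finset.card_insert_of_notMem hmem.2, hA]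
    · intro a ha b hb hbA
      rw [Finset.mem_insert, not_or] at hbA
      rcases Finset.mem_insert.1 ha with rfl | ha
      · exact lt_of_le_of_ne ((S \ A).min'_le b (Finset.mem_sdiff.2 ⟨hb, hbA.2⟩)) (Ne.symm hbA.1)
      · exact hlt a ha b hb hbA.2

/-- A disk that only moves inside the set `P` of pegs is in `P` all the time or never. -/
theorem mem_pegs_of_moves {α : Type*} {c : ℕ → ℕ → α} {P : Finset α} {a b s t t' : ℕ}
    (hP : ∀ r, a ≤ r → r < b → c r s ≠ c (r + 1) s → c r s ∈ P ∧ c (r + 1) s ∈ P)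
    (hat : a ≤ t) (htb : t ≤ b) (hat' : a ≤ t') (htb' : t' ≤ b) (h : c t s ∈ P) : c t' s ∈ P := by
  have key : ∀ r, a ≤ r → r ≤ b → (c r s ∈ P ↔ c a s ∈ P) := by
    intro r har
    induction r, har using Nat.le_induction with
    | base => exact fun _ => Iff.rfl
    | succ r har ih =>
      intro hrb
      rw [← ih (by omega)]
      by_cases hm : c r s = c (r + 1) s
      · rw [hm]
      · have := hP r har (by omega) hm
        tauto
  exact (key t' hat' htb').2 ((key t hat htb).1 h)

/-- A disk without moves stays at its place. -/
theorem eq_of_no_moves {α : Type*} {c : ℕ → ℕ → α} {a b s : ℕ}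
    (h : ∀ r, a ≤ r → r < b → c r s = c (r + 1) s) {t : ℕ} (hat : a ≤ t) (htb : t ≤ b) :
    c t s = c a s := by
  induction t, hat using Nat.le_induction with
  | base => rfl
  | succ r har ih => rw [← h r har (by omega), ih (by omega)]

/-- If a smaller disk rests on a peg, the larger disks move inside the other pegs. -/
theorem moves_avoid_resting {α : Type*} [DecidableEq α] {c : ℕ → ℕ → α} {P : Finset α}
    {a b e s : ℕ} (hstep : ∀ t, a ≤ t → t < b → HanoiStep (c t) (c (t + 1)))
    (hP : ∀ t, a ≤ t → t < b → c t s ≠ c (t + 1) s → c t s ∈ P ∧ c (t + 1) s ∈ P)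
    (hes : e < s) (he : ∀ t, a ≤ t → t < b → c t e = c (t + 1) e) :
    ∀ t, a ≤ t → t < b → c t s ≠ c (t + 1) s →
      c t s ∈ P.erase (c a e) ∧ c (t + 1) s ∈ P.erase (c a e) := by
  intro t hat htb hm
  have h1 := hP t hat htb hm
  have h2 := (hstep t hat htb s hm e hes.ne).2 hes
  rw [eq_of_no_moves he hat htb.le] at h2
  exact ⟨Finset.mem_erase.2 ⟨h2.1.symm, h1.1⟩, Finset.mem_erase.2 ⟨h2.2.symm, h1.2⟩⟩

open Classical in
/-- The number of steps in `[a, b)` that move a disk of `S`. -/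
noncomputable def moveCount {α : Type*} (c : ℕ → ℕ → α) (S : Finset ℕ) (a b : ℕ) : ℕ :=
  ((Finset.Ico a b).filter fun t => ∃ s ∈ S, c t s ≠ c (t + 1) s).card

theorem moveCount_le {α : Type*} (c : ℕ → ℕ → α) (S : Finset ℕ) (a b : ℕ) :
    moveCount c S a b ≤ b - a := by
  classical
  exact (Finset.card_filter_le _ _).trans (Nat.card_Ico a b).le

theorem moveCount_mono {α : Type*} (c : ℕ → ℕ → α) {S S' : Finset ℕ} (hS : S ⊆ S')
    {a b a' b' : ℕ} (ha : a' ≤ a) (hb : b ≤ b') : moveCount c S a b ≤ moveCount c S' a' b' := by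
  classical
  refine Finset.card_le_card fun t ht => ?_
  simp only [Finset.mem_filter, Finset.mem_Ico] at ht ⊢
  obtain ⟨⟨h1, h2⟩, s, hs, hm⟩ := ht
  exact ⟨⟨ha.trans h1, h2.trans_le hb⟩, s, hS hs, hm⟩

theorem moveCount_add {α : Type*} (c : ℕ → ℕ → α) (S : Finset ℕ) {a m b : ℕ} (ham : a ≤ m)
    (hmb : m ≤ b) : moveCount c S a m + moveCount c S m b = moveCount c S a b := by
  classical
  unfold moveCount
  rw [← Finset.card_union_of_disjoint, ← Finset.filter_union, Finset.Ico_union_Ico_eq_Ico ham hmb]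
  exact Finset.disjoint_filter_filter (Finset.Ico_disjoint_Ico_consecutive a m b)

theorem moveCount_pos {α : Type*} {c : ℕ → ℕ → α} {S : Finset ℕ} {a b t s : ℕ} (hat : a ≤ t)
    (htb : t < b) (hs : s ∈ S) (hm : c t s ≠ c (t + 1) s) : 0 < moveCount c S a b := by
  classical
  refine Finset.card_pos.2 ⟨t, ?_⟩
  simp only [Finset.mem_filter, Finset.mem_Ico]
  exact ⟨⟨hat, htb⟩, s, hs, hm⟩

/-- Closes the induction in `card_le_of_moveCount_lt`, and is the reason for the base `3`: one unit
of `3 ^ j * (y + 1) ^ j` for each of two time intervals, and one to absorb the `+ 1`. -/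
theorem pow_add_le_pow (j y : ℕ) :
    3 ^ (j + 1) * y ^ (j + 1) + 2 * (3 ^ j * (y + 1) ^ j) + 1 ≤ 3 ^ (j + 1) * (y + 1) ^ (j + 1) := by
  have h1 : y ^ j ≤ (y + 1) ^ j := Nat.pow_le_pow_left (by omega) j
  have h2 : 1 ≤ 3 ^ j * (y + 1) ^ j := Nat.mul_pos (by positivity) (by positivity)
  have h3 : 3 ^ j * y ^ j * y ≤ 3 ^ j * (y + 1) ^ j * y := by gcongr
  rw [pow_succ, pow_succ, pow_succ]
  nlinarith

/-- If every disk of `S` moves, and all these moves are inside a set of `j + 2` pegs, then the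
number of moves is exponential in `|S| ^ (1 / j)`. -/
theorem card_le_of_moveCount_lt {α : Type*} [DecidableEq α] (c : ℕ → ℕ → α) (j : ℕ) :
    ∀ (x : ℕ) (S : Finset ℕ) (P : Finset α) (a b : ℕ), P.card ≤ j + 2 →
      (∀ t, a ≤ t → t < b → HanoiStep (c t) (c (t + 1))) →
      (∀ s ∈ S, ∃ t, a ≤ t ∧ t < b ∧ c t s ≠ c (t + 1) s) →
      (∀ s ∈ S, ∀ t, a ≤ t → t < b → c t s ≠ c (t + 1) s → c t s ∈ P ∧ c (t + 1) s ∈ P) →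
      moveCount c S a b < 2 ^ x → S.card ≤ 3 ^ j * (x + 1) ^ j := by
  induction j with
  | zero =>
    intro x S P a b hPc hstep hmove hP _
    rw [pow_zero, pow_zero, mul_one, Finset.card_le_one]
    -- With two pegs, a move of `s'` uses both, and the smaller disk `s`, which never leaves `P`,
    -- would need a third.
    have key : ∀ s ∈ S, ∀ s' ∈ S, ¬ s < s' := by
      intro s hs s' hs' hlt
      obtain ⟨t, hat, htb, hm⟩ := hmove s' hs'
      obtain ⟨r, har, hrb, hr⟩ := hmove s hs
      have h1 := hP s' hs' t hat htb hm
      have h2 := (hstep t hat htb s' hm s hlt.ne).2 hlt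
      have h3 := mem_pegs_of_moves (hP s hs) har hrb.le hat htb.le (hP s hs r har hrb hr).1
      have h4 : ({c t s, c t s', c (t + 1) s'} : Finset α).card = 3 :=
        Finset.card_eq_three.2 ⟨_, _, _, h2.1, h2.2, hm, rfl⟩
      have h5 : ({c t s, c t s', c (t + 1) s'} : Finset α) ⊆ P := by
        intro y hy
        simp only [Finset.mem_insert, Finset.mem_singleton] at hy
        rcases hy with rfl | rfl | rfl
        exacts [h3, h1.1, h1.2]
      have := Finset.card_le_card h5
      omega
    intro s hs s' hs'
    exact le_antisymm (not_lt.1 (key s' hs' s hs)) (not_lt.1 (key s hs s' hs'))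
  | succ j ihj =>
    intro x
    induction x with
    | zero =>
      intro S P a b hPc hstep hmove hP hcount
      rcases S.eq_empty_or_nonempty with rfl | ⟨s, hs⟩
      · simp
      · exfalso
        obtain ⟨t, hat, htb, hm⟩ := hmove s hs
        have := moveCount_pos hat htb hs hm
        omega
    | succ x ihx =>
      intro S P a b hPc hstep hmove hP hcount
      by_contra! hS
      have hpow := pow_add_le_pow j (x + 1)
      -- `A` consists of the smallest disks of `S`, one more than fewer than `2 ^ x` moves can
      -- displace.
      obtain ⟨A, hAS, hAc, hAlt⟩ :=
        exists_initial_segment S (3 ^ (j + 1) * (x + 1) ^ (j + 1) + 1) (by omega)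
      have hex : ∃ t, ∀ s ∈ A, ∃ r, a ≤ r ∧ r < t ∧ c r s ≠ c (r + 1) s :=
        ⟨b, fun s hs => hmove s (hAS hs)⟩
      classical
      obtain ⟨T, hT, hTmin⟩ : ∃ T, (∀ s ∈ A, ∃ r, a ≤ r ∧ r < T ∧ c r s ≠ c (r + 1) s) ∧
          ∀ T' < T, ¬ ∀ s ∈ A, ∃ r, a ≤ r ∧ r < T' ∧ c r s ≠ c (r + 1) s :=
        ⟨Nat.find hex, Nat.find_spec hex, fun T' h => Nat.find_min hex h⟩
      have hTb : T ≤ b := by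
        by_contra! h
        exact hTmin b h fun s hs => hmove s (hAS hs)
      obtain ⟨a₀, ha₀⟩ : A.Nonempty := Finset.card_pos.1 (by omega)
      obtain ⟨r₀, har₀, hr₀T, -⟩ := hT a₀ ha₀
      -- From here on `T + 1` is the earliest time by which all of `A` has moved, so step `T` is the
      -- first move of some `e ∈ A`.
      obtain ⟨T, rfl⟩ : ∃ T', T = T' + 1 := ⟨T - 1, by omega⟩
      have hlast := hTmin T (Nat.lt_succ_self T)
      push Not at hlast
      obtain ⟨e, heA, he⟩ := hlast
      have heT : c T e ≠ c (T + 1) e := by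
        obtain ⟨r, har, hrT, hr⟩ := hT e heA
        rcases Nat.lt_succ_iff_lt_or_eq.1 hrT with h | rfl
        · exact absurd (he r har h) hr
        · exact hr
      have hfirst : 2 ^ x ≤ moveCount c A a (T + 1) := by
        by_contra! h
        have := ihx A P a (T + 1) hPc (fun t h1 h2 => hstep t h1 (by omega)) hT
          (fun s hs t h1 h2 => hP s (hAS hs) t h1 (by omega)) h
        omega
      -- If all of `A` moved again, both intervals would contain `2 ^ x` moves, against the bound `2
      -- ^ (x + 1)`.
      have hsecond : ∃ f ∈ A, ∀ t, T + 1 ≤ t → t < b → c t f = c (t + 1) f := by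
        by_contra! h
        have h2 : 2 ^ x ≤ moveCount c A (T + 1) b := by
          by_contra! h2
          have := ihx A P (T + 1) b hPc (fun t h1 h2 => hstep t (by omega) h2) h
            (fun s hs t h1 h2 => hP s (hAS hs) t (by omega) h2) h2
          omega
        have h3 := moveCount_add c A (show a ≤ T + 1 by omega) hTb
        have h4 := moveCount_mono c hAS le_rfl (le_refl b) (a := a)
        rw [pow_succ] at hcount
        omega
      obtain ⟨f, hfA, hf⟩ := hsecond
      have hmemP : ∀ s ∈ S, ∀ t, a ≤ t → t ≤ b → c t s ∈ P := by
        intro s hs t hat htb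
        obtain ⟨r, har, hrb, hr⟩ := hmove s hs
        exact mem_pegs_of_moves (hP s hs) har hrb.le hat htb (hP s hs r har hrb hr).1
      -- While `g ∈ A` rests, its peg is closed to the larger disks of `S \ A`. They have one peg
      -- fewer, and the induction hypothesis for `j` applies.
      have hrest : ∀ a' b' g, a ≤ a' → a' ≤ b → b' ≤ b → g ∈ A →
          (∀ t, a' ≤ t → t < b' → c t g = c (t + 1) g) → ∀ B ⊆ S \ A,
          (∀ s ∈ B, ∃ t, a' ≤ t ∧ t < b' ∧ c t s ≠ c (t + 1) s) →
          B.card ≤ 3 ^ j * (x + 1 + 1) ^ j := by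
        intro a' b' g haa' hab' hbb' hg hgr B hB hBm
        have hBS : B ⊆ S := hB.trans Finset.sdiff_subset
        refine ihj (x + 1) B (P.erase (c a' g)) a' b' ?_
          (fun t h1 h2 => hstep t (by omega) (by omega)) hBm ?_
          ((moveCount_mono c hBS haa' hbb').trans_lt hcount)
        · rw [Finset.card_erase_of_mem (hmemP g (hAS hg) a' haa' hab')]
          omega
        · intro s hs
          have hs' := Finset.mem_sdiff.1 (hB hs)
          exact moves_avoid_resting (fun t h1 h2 => hstep t (by omega) (by omega))
            (fun t h1 h2 => hP s hs'.1 t (by omega) (by omega)) (hAlt g hg s hs'.1 hs'.2) hgr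
      have h1 := hrest a T e le_rfl (by omega) (by omega) heA he
        ((S \ A).filter fun s => ∃ t, a ≤ t ∧ t < T ∧ c t s ≠ c (t + 1) s)
        (Finset.filter_subset _ _) fun s hs => (Finset.mem_filter.1 hs).2
      have h2 := hrest (T + 1) b f (by omega) hTb le_rfl hfA hf
        ((S \ A).filter fun s => ∃ t, T + 1 ≤ t ∧ t < b ∧ c t s ≠ c (t + 1) s)
        (Finset.filter_subset _ _) fun s hs => (Finset.mem_filter.1 hs).2
      -- Step `T` itself moves only `e`, so every disk of `S \ A` moves before it, while `e` rests,
      -- or after it, while `f` rests.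
      have hcover : S \ A ⊆
          ((S \ A).filter fun s => ∃ t, a ≤ t ∧ t < T ∧ c t s ≠ c (t + 1) s) ∪
          ((S \ A).filter fun s => ∃ t, T + 1 ≤ t ∧ t < b ∧ c t s ≠ c (t + 1) s) := by
        intro s hs
        have hs' := Finset.mem_sdiff.1 hs
        obtain ⟨t, hat, htb, hm⟩ := hmove s hs'.1
        rw [Finset.mem_union, Finset.mem_filter, Finset.mem_filter]
        rcases lt_trichotomy t T with h | rfl | h
        · exact Or.inl ⟨hs, t, hat, h, hm⟩
        · have hse : s ≠ e := fun h => hs'.2 (h ▸ heA)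
          exact absurd (hstep t hat htb e heT s hse).1 hm
        · exact Or.inr ⟨hs, t, h, htb, hm⟩
      have h3 := (Finset.card_le_card hcover).trans (Finset.card_union_le _ _)
      rw [Finset.card_sdiff_of_subset hAS] at h3
      omega

/-! ### Encoding a reachable position by the disks of small rank -/

/-- The number of smaller disks on the same peg. -/
def diskRank {α : Type*} [DecidableEq α] (u : ℕ → α) (s : ℕ) : ℕ :=
  ((Finset.range s).filter fun y => u y = u s).card

theorem diskRank_lt {α : Type*} [DecidableEq α] {u : ℕ → α} {y s : ℕ} (hys : y < s)
    (h : u y = u s) : diskRank u y < diskRank u s := by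
  refine Finset.card_lt_card ⟨fun z hz => ?_, fun hsub => ?_⟩
  · rw [Finset.mem_filter, Finset.mem_range] at hz ⊢
    exact ⟨hz.1.trans hys, hz.2.trans h⟩
  · have := hsub (Finset.mem_filter.2 ⟨Finset.mem_range.2 hys, h⟩)
    simp at this

theorem eq_of_diskRank_eq {α : Type*} [DecidableEq α] {u : ℕ → α} {y s : ℕ} (h : u y = u s)
    (hr : diskRank u y = diskRank u s) : y = s := by
  rcases lt_trichotomy y s with hlt | rfl | hlt
  · exact absurd hr (diskRank_lt hlt h).ne
  · rfl
  · exact absurd hr (diskRank_lt hlt h.symm).ne'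

/-- A disk that has changed its place within fewer than `2 ^ x` steps had few smaller disks on its
initial peg. -/
theorem HanoiReach.diskRank_lt {α : Type*} [DecidableEq α] [Fintype α] {j x n : ℕ}
    (hα : Fintype.card α ≤ j + 2) {u v : ℕ → α} (h : HanoiReach n u v) (hn : n < 2 ^ x) {s : ℕ}
    (hs : u s ≠ v s) : diskRank u s < 3 ^ j * (x + 1) ^ j := by
  obtain ⟨c, h0, hcn, hc⟩ := h.exists_path
  have hfin : (⋃ t ∈ Set.Iio n, {s | c t s ≠ c (t + 1) s}).Finite := by
    refine (Set.finite_Iio n).biUnion fun t ht => Set.Subsingleton.finite fun s hs s' hs' => ?_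
    by_contra hne
    exact hs (hc t ht s' hs' s hne).1
  have hmem : ∀ s, s ∈ hfin.toFinset ↔ ∃ t < n, c t s ≠ c (t + 1) s := by
    intro s
    simp
  have hcount : moveCount c hfin.toFinset 0 n < 2 ^ x :=
    (moveCount_le c _ 0 n).trans_lt hn
  have hcard := card_le_of_moveCount_lt c j x hfin.toFinset Finset.univ 0 n hα
    (fun t _ ht => hc t ht) (fun s hs => by simpa using (hmem s).1 hs) (by simp) hcount
  refine lt_of_lt_of_le ?_ hcard
  have hsS : ∃ t < n, c t s ≠ c (t + 1) s := by
    by_contra! hno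
    exact hs (h0 ▸ hcn ▸ (eq_of_no_moves (fun r _ hr => hno r hr) n.zero_le le_rfl).symm)
  refine Finset.card_lt_card ⟨fun y hy => ?_, fun hsub => ?_⟩
  · rw [Finset.mem_filter, Finset.mem_range] at hy
    rw [hmem]
    by_contra! hno
    -- If a smaller disk `y` on the initial peg of `s` never moved, all moves of `s` would avoid
    -- that peg, where `s` starts.
    have key := moves_avoid_resting (P := Finset.univ) (a := 0) (b := n)
      (fun t _ ht => hc t ht) (by simp) hy.1 (fun t _ ht => hno t ht)
    obtain ⟨t, ht, hm⟩ := hsS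
    have := mem_pegs_of_moves key t.zero_le ht.le le_rfl n.zero_le (key t t.zero_le ht hm).1
    rw [h0] at this
    exact (Finset.mem_erase.1 this).1 hy.2.symm
  -- The inequality is strict because `s` moves but does not count towards its own rank.
  · have := hsub ((hmem s).2 hsS)
    simp at this

open Classical in
/-- The places after a walk of the disks with few smaller disks on their initial pegs. -/
noncomputable def placesOfRank {α : Type*} [DecidableEq α] (u : ℕ → α) (m : ℕ) (v : ℕ → α) :
    α × Fin m → α :=
  -- A peg may hold too few disks to attain a given rank; `u 0` is then an arbitrary value.
  fun z => if h : ∃ s, u s = z.1 ∧ diskRank u s = z.2 then v h.choose else u 0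

/-- Peg and rank in `u` identify a disk, and the disks of rank at least `m` have not changed their
place. -/
theorem placesOfRank_injOn {α : Type*} [DecidableEq α] (u : ℕ → α) (m : ℕ) :
    Set.InjOn (placesOfRank u m) {v | ∀ s, u s ≠ v s → diskRank u s < m} := by
  intro v hv v' hv' h
  funext s
  by_cases hs : diskRank u s < m
  · have hex : ∃ s', u s' = u s ∧ diskRank u s' = diskRank u s := ⟨s, rfl, rfl⟩
    have h1 := congrFun h (u s, ⟨diskRank u s, hs⟩)
    have h2 : hex.choose = s := eq_of_diskRank_eq hex.choose_spec.1 hex.choose_spec.2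
    simp only [placesOfRank] at h1
    rwa [dif_pos hex, dif_pos hex, h2] at h1
  · have h1 : u s = v s := not_not.1 fun hne => hs (hv s hne)
    have h2 : u s = v' s := not_not.1 fun hne => hs (hv' s hne)
    rw [← h1, h2]

/-! ### Gathering disks on one peg -/

/-- The position obtained from `u` by putting all disks of `D` on the peg `p`. -/
def gathered {α : Type*} (D : Finset ℕ) (p : α) (u : ℕ → α) : ℕ → α :=
  fun d => if d ∈ D then p else u d

/-- The number of disks that `j + 2` pegs allow to gather in `5 ^ x` steps. -/
def gatherSize : ℕ → ℕ → ℕ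
  | 0, _ => 1
  | _ + 1, 0 => 1
  | j + 1, x + 1 => gatherSize (j + 1) x + gatherSize j x

theorem gather_of_card_le_one {α : Type*} {D : Finset ℕ} {P : Finset α} {p : α} {u : ℕ → α}
    (hD : D.card ≤ 1) (hp : p ∈ P) (hDP : ∀ d ∈ D, u d ∈ P)
    (hfree : ∀ d ∈ D, ∀ e < d, e ∉ D → u e ∉ P) : HanoiStep u (gathered D p u) := by
  have key : ∀ d, d ∉ D → gathered D p u d = u d := fun d hd => if_neg hd
  intro s hs e hes
  have hsD : s ∈ D := by
    by_contra h
    exact hs (key s h).symm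
  have heD : e ∉ D := fun he => hes (Finset.card_le_one.1 hD e he s hsD)
  refine ⟨(key e heD).symm, fun hlt => ⟨fun h => ?_, fun h => ?_⟩⟩
  · exact hfree s hsD e hlt heD (h ▸ hDP s hsD)
  · rw [gathered, if_pos hsD] at h
    exact hfree s hsD e hlt heD (h ▸ hp)

/-- Let `A` be the small disks of `D`. Stack `A` on `q`; bring the large disks that are not on `q`
to `p` without using `q`; move `A` to `r`, which frees the large disks left on `q`; gather all large
disks on `p` without using `r`; bring `A` to `p`. These five phases explain the base `5`. The last
hypothesis keeps smaller disks outside `D` from blocking the pegs of `P`. -/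
theorem gather {α : Type*} [DecidableEq α] (j : ℕ) :
    ∀ (x : ℕ) (D : Finset ℕ) (P : Finset α) (p : α) (u : ℕ → α), j + 2 ≤ P.card →
      D.card ≤ gatherSize j x → p ∈ P → (∀ d ∈ D, u d ∈ P) →
      (∀ d ∈ D, ∀ e < d, e ∉ D → u e ∉ P) → HanoiReach (5 ^ x) u (gathered D p u) := by
  induction j with
  | zero =>
    intro x D P p u _ hD hp hDP hfree
    rw [gatherSize] at hD
    exact (HanoiReach.of_step (gather_of_card_le_one hD hp hDP hfree)).mono
      (Nat.one_le_pow _ _ (by norm_num))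
  | succ j ihj =>
    intro x
    induction x with
    | zero =>
      intro D P p u _ hD hp hDP hfree
      exact HanoiReach.of_step (gather_of_card_le_one hD hp hDP hfree)
    | succ x ihx =>
      intro D P p u hP hD hp hDP hfree
      rw [gatherSize] at hD
      obtain ⟨A, hAD, hAc, hlt⟩ :=
        exists_initial_segment D (min D.card (gatherSize (j + 1) x)) (min_le_left _ _)
      have hB : (D \ A).card ≤ gatherSize j x := by
        rw [Finset.card_sdiff_of_subset hAD, hAc]
        omega
      replace hAc : A.card ≤ gatherSize (j + 1) x := hAc ▸ min_le_right _ _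
      obtain ⟨q, hq⟩ : (P.erase p).Nonempty := by
        rw [← Finset.card_pos, Finset.card_erase_of_mem hp]
        omega
      obtain ⟨r, hr⟩ : ((P.erase p).erase q).Nonempty := by
        rw [← Finset.card_pos, Finset.card_erase_of_mem hq, Finset.card_erase_of_mem hp]
        omega
      simp only [Finset.mem_erase] at hq hr
      have hcq : j + 2 ≤ (P.erase q).card := by
        rw [Finset.card_erase_of_mem hq.2]
        omega
      have hcr : j + 2 ≤ (P.erase r).card := by
        rw [Finset.card_erase_of_mem hr.2.2]
        omega
      have hAfree : ∀ d ∈ A, ∀ e < d, e ∉ A → e ∉ D := fun d hd e hed heA heD =>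
        absurd (hlt d hd e heD heA) (by omega)
      set B := (D \ A).filter fun d => u d ≠ q with hBdef
      have hBmem : ∀ d, d ∈ B ↔ (d ∈ D ∧ d ∉ A) ∧ u d ≠ q := fun d => by
        rw [hBdef, Finset.mem_filter, Finset.mem_sdiff]
      have hBD : ∀ d ∈ B, d ∈ D := fun d hd => ((hBmem d).1 hd).1.1
      have hBA : ∀ d ∈ B, d ∉ A := fun d hd => ((hBmem d).1 hd).1.2
      have s1 : HanoiReach (5 ^ x) u (gathered A q u) :=
        ihx A P q u hP hAc hq.2 (fun d hd => hDP d (hAD hd)) fun d hd e hed heA =>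
          hfree d (hAD hd) e hed (hAfree d hd e hed heA)
      have s2 : HanoiReach (5 ^ x) (gathered A q u) (gathered B p (gathered A q u)) := by
        refine ihj x B (P.erase q) p _ hcq ((Finset.card_filter_le _ _).trans hB)
          (Finset.mem_erase.2 ⟨hq.1.symm, hp⟩) (fun d hd => ?_) fun d hd e hed heB => ?_
        · rw [gathered, if_neg (hBA d hd)]
          exact Finset.mem_erase.2 ⟨((hBmem d).1 hd).2, hDP d (hBD d hd)⟩
        · rw [gathered]
          split_ifs with heA
          · simp
          · by_cases heD : e ∈ D
            · have : u e = q := by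
                by_contra hne
                exact heB ((hBmem e).2 ⟨⟨heD, heA⟩, hne⟩)
              simp [this]
            · exact fun hmem => hfree d (hBD d hd) e hed heD (Finset.mem_of_mem_erase hmem)
      set u₂ := gathered B p (gathered A q u) with hu₂
      have hu₂A : ∀ d ∈ A, u₂ d = q := fun d hd => by
        rw [hu₂, gathered, if_neg fun h => hBA d h hd, gathered, if_pos hd]
      have hu₂D : ∀ d, d ∉ D → u₂ d = u d := fun d hd => by
        rw [hu₂, gathered, if_neg fun h => hd (hBD d h), gathered, if_neg fun h => hd (hAD h)]
      have hu₂B : ∀ d ∈ D, d ∉ A → u₂ d = p ∨ u₂ d = q := fun d hd hdA => by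
        rw [hu₂, gathered, gathered, if_neg hdA]
        split_ifs with h
        · exact Or.inl rfl
        · refine Or.inr ?_
          by_contra hne
          exact h ((hBmem d).2 ⟨⟨hd, hdA⟩, hne⟩)
      have s3 : HanoiReach (5 ^ x) u₂ (gathered A r u₂) := by
        refine ihx A P r u₂ hP hAc hr.2.2 (fun d hd => ?_) fun d hd e hed heA => ?_
        · rw [hu₂A d hd]
          exact hq.2
        · rw [hu₂D e (hAfree d hd e hed heA)]
          exact hfree d (hAD hd) e hed (hAfree d hd e hed heA)
      have s4 : HanoiReach (5 ^ x) (gathered A r u₂)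
          (gathered (D \ A) p (gathered A r u₂)) := by
        refine ihj x (D \ A) (P.erase r) p _ hcr hB
          (Finset.mem_erase.2 ⟨hr.2.1.symm, hp⟩) (fun d hd => ?_) fun d hd e hed heB => ?_
        · rw [Finset.mem_sdiff] at hd
          rw [gathered, if_neg hd.2]
          rcases hu₂B d hd.1 hd.2 with h | h <;> rw [h, Finset.mem_erase]
          · exact ⟨hr.2.1.symm, hp⟩
          · exact ⟨hr.1.symm, hq.2⟩
        · rw [gathered]
          split_ifs with heA
          · simp
          · have heD : e ∉ D := fun heD => heB (Finset.mem_sdiff.2 ⟨heD, heA⟩)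
            rw [hu₂D e heD]
            exact fun hmem => hfree d (Finset.mem_sdiff.1 hd).1 e hed heD
              (Finset.mem_of_mem_erase hmem)
      set u₄ := gathered (D \ A) p (gathered A r u₂) with hu₄
      have hu₄A : ∀ d ∈ A, u₄ d = r := fun d hd => by
        rw [hu₄, gathered, if_neg fun h => (Finset.mem_sdiff.1 h).2 hd, gathered, if_pos hd]
      have hu₄D : ∀ d, d ∉ D → u₄ d = u d := fun d hd => by
        rw [hu₄, gathered, if_neg fun h => hd (Finset.mem_sdiff.1 h).1, gathered,
          if_neg fun h => hd (hAD h), hu₂D d hd]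
      have s5 : HanoiReach (5 ^ x) u₄ (gathered A p u₄) := by
        refine ihx A P p u₄ hP hAc hp (fun d hd => ?_) fun d hd e hed heA => ?_
        · rw [hu₄A d hd]
          exact hr.2.2
        · rw [hu₄D e (hAfree d hd e hed heA)]
          exact hfree d (hAD hd) e hed (hAfree d hd e hed heA)
      have hfinal : gathered A p u₄ = gathered D p u := by
        funext d
        by_cases hdA : d ∈ A
        · rw [gathered, gathered, if_pos hdA, if_pos (hAD hdA)]
        · by_cases hdD : d ∈ D
          · rw [gathered, gathered, if_neg hdA, if_pos hdD, hu₄, gathered,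
              if_pos (Finset.mem_sdiff.2 ⟨hdD, hdA⟩)]
          · rw [gathered, gathered, if_neg hdA, if_neg hdD, hu₄D d hdD]
      rw [← hfinal]
      refine ((((s1.trans s2).trans s3).trans s4).trans s5).mono ?_
      rw [pow_succ]
      omega

theorem succ_pow_le (y j : ℕ) :
    (y + 1) ^ (j + 1) ≤ y ^ (j + 1) + (j + 1) * (y + 1) ^ j := by
  induction j with
  | zero => simp
  | succ j ih =>
    have h1 := Nat.mul_le_mul_left y ih
    have h2 : (y + 1) ^ (j + 1 + 1) = y * (y + 1) ^ (j + 1) + (y + 1) ^ (j + 1) := by ring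
    have h3 : (y + 1) ^ (j + 1) = y * (y + 1) ^ j + (y + 1) ^ j := by ring
    have h4 : y * (y ^ (j + 1) + (j + 1) * (y + 1) ^ j) =
        y ^ (j + 1 + 1) + (j + 1) * (y * (y + 1) ^ j) := by ring
    have h5 : (j + 1) * (y * (y + 1) ^ j) ≤ (j + 1) * (y + 1) ^ (j + 1) := by
      rw [h3]
      exact Nat.mul_le_mul_left _ (Nat.le_add_right _ _)
    have h6 : (j + 1 + 1) * (y + 1) ^ (j + 1) = (j + 1) * (y + 1) ^ (j + 1) + (y + 1) ^ (j + 1) := by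
      ring
    omega

/-- The recursion of `gatherSize` is Pascal's rule. The increment of `(x + 1) ^ (j + 1)` is at most
`(j + 1) * (x + 2) ^ j ≤ (j + 1) * 2 ^ j * (x + 1) ^ j`, which gives the constant. -/
theorem exists_pow_le_gatherSize (j : ℕ) :
    ∃ K : ℕ, 0 < K ∧ ∀ x, (x + 1) ^ j ≤ K * gatherSize j x := by
  induction j with
  | zero => exact ⟨1, one_pos, fun x => by simp [gatherSize]⟩
  | succ j ih =>
    obtain ⟨K, hK, h⟩ := ih
    have hK' : 0 < (j + 1) * 2 ^ j * K := by positivity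
    refine ⟨(j + 1) * 2 ^ j * K, hK', fun x => ?_⟩
    induction x with
    | zero => simpa [gatherSize] using Nat.succ_le_of_lt hK'
    | succ x ihx =>
      rw [gatherSize, mul_add]
      refine (succ_pow_le (x + 1) j).trans (add_le_add ihx ?_)
      rw [mul_assoc, mul_assoc]
      refine Nat.mul_le_mul_left _ ?_
      calc (x + 1 + 1) ^ j ≤ (2 * (x + 1)) ^ j := Nat.pow_le_pow_left (by omega) j
        _ = 2 ^ j * (x + 1) ^ j := mul_pow _ _ _
        _ ≤ 2 ^ j * (K * gatherSize j x) := Nat.mul_le_mul_left _ (h x)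

/-! ### The Schreier graph as the graph of the game -/

section Hanoi

variable {k : ℕ}

theorem hanoi_stateAt_e (w : ℕ → Fin k) (n : ℕ) :
    (hanoiAutomaton k).stateAt .e w n = .e := by
  induction n with
  | zero => rfl
  | succ n ih => rw [InvertibleAutomaton.stateAt, ih]; rfl

theorem hanoi_act_e (w : ℕ → Fin k) : (hanoiAutomaton k).act .e w = w := by
  funext n
  rw [InvertibleAutomaton.act, hanoi_stateAt_e]
  rfl

theorem hanoi_stateAt_a_of_exists {i j : Fin k} (h : i < j) (w : ℕ → Fin k) {n : ℕ}
    (hn : ∃ m < n, w m = i ∨ w m = j) : (hanoiAutomaton k).stateAt (.a i j h) w n = .e := by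
  induction n with
  | zero => simp at hn
  | succ n ih =>
    rw [InvertibleAutomaton.stateAt]
    by_cases hn' : ∃ m < n, w m = i ∨ w m = j
    · rw [ih hn']
      rfl
    · obtain ⟨m, hm, hw⟩ := hn
      obtain rfl : m = n := by
        by_contra hne
        exact hn' ⟨m, by omega, hw⟩
      have : (hanoiAutomaton k).stateAt (.a i j h) w m = .e ∨
          (hanoiAutomaton k).stateAt (.a i j h) w m = .a i j h := by
        clear ih hn' hm hw
        induction m with
        | zero => exact Or.inr rfl
        | succ m ih =>
          rw [InvertibleAutomaton.stateAt]
          rcases ih with ih | ih <;> rw [ih]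
          · exact Or.inl rfl
          · simp only [hanoiAutomaton]
            split_ifs <;> simp
      rcases this with h' | h' <;> rw [h']
      · rfl
      · simp [hanoiAutomaton, hw]

theorem hanoi_stateAt_a_of_forall {i j : Fin k} (h : i < j) (w : ℕ → Fin k) {n : ℕ}
    (hn : ∀ m < n, w m ≠ i ∧ w m ≠ j) :
    (hanoiAutomaton k).stateAt (.a i j h) w n = .a i j h := by
  induction n with
  | zero => rfl
  | succ n ih =>
    rw [InvertibleAutomaton.stateAt, ih fun m hm => hn m (by omega)]
    simp [hanoiAutomaton, hn n (Nat.lt_succ_self n)]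

theorem hanoi_act_a_of_exists {i j : Fin k} (h : i < j) (w : ℕ → Fin k) {n : ℕ}
    (hn : ∃ m < n, w m = i ∨ w m = j) : (hanoiAutomaton k).act (.a i j h) w n = w n := by
  rw [InvertibleAutomaton.act, hanoi_stateAt_a_of_exists h w hn]
  rfl

theorem hanoi_act_a_of_forall {i j : Fin k} (h : i < j) (w : ℕ → Fin k) {n : ℕ}
    (hn : ∀ m < n, w m ≠ i ∧ w m ≠ j) :
    (hanoiAutomaton k).act (.a i j h) w n = Equiv.swap i j (w n) := by
  rw [InvertibleAutomaton.act, hanoi_stateAt_a_of_forall h w hn]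
  rfl

theorem hanoiStep_act (s : HanoiState k) (w : ℕ → Fin k) :
    HanoiStep w ((hanoiAutomaton k).act s w) := by
  cases s with
  | e =>
    rw [hanoi_act_e]
    exact .refl w
  | a i j h =>
    intro s hs
    have hfree : ∀ m < s, w m ≠ i ∧ w m ≠ j := by
      by_contra! hno
      obtain ⟨m, hm, hmw⟩ := hno
      refine hs (hanoi_act_a_of_exists h w ⟨m, hm, ?_⟩).symm
      tauto
    rw [hanoi_act_a_of_forall h w hfree] at hs ⊢
    have hws : w s = i ∨ w s = j := by
      by_contra! hno
      exact hs (Equiv.swap_apply_of_ne_of_ne hno.1 hno.2).symm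
    intro e he
    rcases lt_or_gt_of_ne he with hlt | hlt
    · refine ⟨?_, fun _ => ?_⟩
      · rw [hanoi_act_a_of_forall h w fun m hm => hfree m (hm.trans hlt),
          Equiv.swap_apply_of_ne_of_ne (hfree e hlt).1 (hfree e hlt).2]
      · rcases hws with hw | hw <;> rw [hw]
        · rw [Equiv.swap_apply_left]
          exact hfree e hlt
        · rw [Equiv.swap_apply_right]
          exact (hfree e hlt).symm
    · exact ⟨(hanoi_act_a_of_exists h w ⟨s, hlt, hws⟩).symm, fun h' => absurd h' (by omega)⟩

/-- No smaller disk lies on the two pegs of a legal move, so the moved disk is the first occurrence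
of either letter, which is the one that `a_(ij)` changes. -/
theorem HanoiStep.exists_act {u v : ℕ → Fin k} (h : HanoiStep u v) :
    ∃ s, (hanoiAutomaton k).act s u = v := by
  by_cases huv : u = v
  · exact ⟨.e, by rw [hanoi_act_e, huv]⟩
  obtain ⟨s, hs⟩ := Function.ne_iff.1 huv
  have key : ∀ (i j : Fin k) (hij : i < j), (u s = i ∧ v s = j ∨ u s = j ∧ v s = i) →
      (hanoiAutomaton k).act (.a i j hij) u = v := by
    intro i j hij huv
    have hfree : ∀ m < s, u m ≠ i ∧ u m ≠ j := by
      intro m hm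
      have := (h s hs m hm.ne).2 hm
      rcases huv with ⟨h1, h2⟩ | ⟨h1, h2⟩ <;> rw [h1, h2] at this
      · exact this
      · exact this.symm
    funext e
    rcases lt_trichotomy e s with hlt | rfl | hlt
    · rw [hanoi_act_a_of_forall hij u fun m hm => hfree m (hm.trans hlt),
        Equiv.swap_apply_of_ne_of_ne (hfree e hlt).1 (hfree e hlt).2]
      exact (h s hs e hlt.ne).1
    · rw [hanoi_act_a_of_forall hij u hfree]
      rcases huv with ⟨h1, h2⟩ | ⟨h1, h2⟩ <;> rw [h1, h2]
      · exact Equiv.swap_apply_left i j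
      · exact Equiv.swap_apply_right i j
    · rw [hanoi_act_a_of_exists hij u ⟨s, hlt, huv.imp And.left And.left⟩]
      exact (h s hs e hlt.ne').1
  rcases lt_or_gt_of_ne hs with hlt | hlt
  · exact ⟨_, key _ _ hlt (Or.inl ⟨rfl, rfl⟩)⟩
  · exact ⟨_, key _ _ hlt (Or.inr ⟨rfl, rfl⟩)⟩

/-- The orbit of `w` under the Hanoi Towers group. -/
abbrev HanoiOrbit (w : ℕ → Fin k) : Type :=
  MulAction.orbit (Subgroup.closure (Set.range (hanoiAutomaton k).toPerm)) w

theorem hanoiGraph_adj {w : ℕ → Fin k} {u v : HanoiOrbit w} :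
    ((hanoiAutomaton k).schreierGraph w).Adj u v ↔ u ≠ v ∧ HanoiStep (u : ℕ → Fin k) v := by
  refine and_congr_right fun _ => ⟨?_, fun h => ?_⟩
  · rintro ⟨t, ⟨s, rfl⟩ | ⟨s, hs⟩, htu⟩
    · rw [← htu]
      exact hanoiStep_act s _
    · have : (hanoiAutomaton k).act s v = u := by
        change (hanoiAutomaton k).toPerm s v = u
        rw [hs, ← htu]
        exact t.symm_apply_apply _
      rw [← this]
      exact (hanoiStep_act s _).symm
  · obtain ⟨s, hs⟩ := h.exists_act
    exact ⟨_, Or.inl ⟨s, rfl⟩, hs⟩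

/-- Each move is the action of a generator, so play never leaves the orbit. -/
theorem HanoiReach.exists_edist_le {w : ℕ → Fin k} {n : ℕ} {u v : ℕ → Fin k}
    (h : HanoiReach n u v) (hu : u ∈ MulAction.orbit
      (Subgroup.closure (Set.range (hanoiAutomaton k).toPerm)) w) :
    ∃ v' : HanoiOrbit w, (v' : ℕ → Fin k) = v ∧
      ((hanoiAutomaton k).schreierGraph w).edist ⟨u, hu⟩ v' ≤ n := by
  induction h with
  | zero => exact ⟨⟨_, hu⟩, rfl, by simp⟩
  | @succ n u v x _ hs ih =>
    obtain ⟨v', rfl, hd⟩ := ih hu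
    obtain ⟨s, rfl⟩ := hs.exists_act
    let g : Subgroup.closure (Set.range (hanoiAutomaton k).toPerm) :=
      ⟨_, Subgroup.subset_closure ⟨s, rfl⟩⟩
    refine ⟨g • v', rfl, ?_⟩
    rw [Nat.cast_add, Nat.cast_one]
    refine (SimpleGraph.edist_triangle (v := v')).trans (add_le_add hd ?_)
    by_cases hne : v' = g • v'
    · rw [← hne]
      simp
    · have hadj : ((hanoiAutomaton k).schreierGraph w).Adj v' (g • v') :=
        hanoiGraph_adj.2 ⟨hne, hs⟩
      exact (SimpleGraph.edist_eq_one_iff_adj.2 hadj).le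

theorem hanoiReach_of_walk {w : ℕ → Fin k} {u v : HanoiOrbit w}
    (p : ((hanoiAutomaton k).schreierGraph w).Walk u v) :
    HanoiReach p.length (u : ℕ → Fin k) v := by
  induction p with
  | nil => exact .zero _
  | cons h p ih =>
    rw [SimpleGraph.Walk.length_cons, add_comm]
    exact (HanoiReach.of_step (hanoiGraph_adj.1 h).2).trans ih

theorem hanoiGraph_edist_le_iff {w : ℕ → Fin k} {u v : HanoiOrbit w} {n : ℕ} :
    ((hanoiAutomaton k).schreierGraph w).edist u v ≤ n ↔ HanoiReach n (u : ℕ → Fin k) v := by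
  refine ⟨fun h => ?_, fun h => ?_⟩
  · obtain ⟨p, hp⟩ := SimpleGraph.exists_walk_of_edist_ne_top
      (ne_top_of_le_ne_top (ENat.natCast_ne_top n) h)
    rw [← hp] at h
    exact (hanoiReach_of_walk p).mono (by exact_mod_cast h)
  · obtain ⟨v', hv', h'⟩ := h.exists_edist_le u.2
    obtain rfl := Subtype.ext hv'
    exact h'

theorem hanoiGraph_connected (w : ℕ → Fin k) :
    ((hanoiAutomaton k).schreierGraph w).Connected := by
  have key : ∀ g ∈ Subgroup.closure (Set.range (hanoiAutomaton k).toPerm),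
      ∀ u : ℕ → Fin k, ∃ n, HanoiReach n u (g u) := by
    intro g hg
    induction hg using Subgroup.closure_induction with
    | mem g hg =>
      obtain ⟨s, rfl⟩ := hg
      exact fun u => ⟨1, .of_step (hanoiStep_act s u)⟩
    | one => exact fun u => ⟨0, .zero u⟩
    | mul g h _ _ ihg ihh =>
      intro u
      obtain ⟨n, hn⟩ := ihh u
      obtain ⟨m, hm⟩ := ihg (h u)
      exact ⟨n + m, hn.trans hm⟩
    | inv g _ ih =>
      intro u
      obtain ⟨n, hn⟩ := ih (g⁻¹ u)
      refine ⟨n, ?_⟩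
      rw [show g (g⁻¹ u) = u from g.apply_symm_apply u] at hn
      exact hn.symm
  have hw : ∀ v : HanoiOrbit w,
      ((hanoiAutomaton k).schreierGraph w).Reachable ⟨w, MulAction.mem_orbit_self w⟩ v := by
    rintro ⟨_, g, rfl⟩
    obtain ⟨n, hn⟩ := key g g.2 w
    exact SimpleGraph.reachable_of_edist_ne_top
      (ne_top_of_le_ne_top (ENat.natCast_ne_top n) (hanoiGraph_edist_le_iff.2 hn))
  have : Nonempty (HanoiOrbit w) := ⟨⟨w, MulAction.mem_orbit_self w⟩⟩
  exact ⟨fun u v => (hw u).symm.trans (hw v)⟩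

/-! ### Sizes of balls -/

theorem hanoiGraph_ball_finite_and_ncard_le {j : ℕ} (hj : k = j + 2) {w : ℕ → Fin k}
    (v : HanoiOrbit w) {n x : ℕ} (hn : n < 2 ^ x) :
    {u | ((hanoiAutomaton k).schreierGraph w).edist v u ≤ (n : ℕ∞)}.Finite ∧
      growthFunction ((hanoiAutomaton k).schreierGraph w) v n ≤
        k ^ (k * (3 ^ j * (x + 1) ^ j)) := by
  set m := 3 ^ j * (x + 1) ^ j
  have hinj : Set.InjOn (fun u : HanoiOrbit w => placesOfRank (v : ℕ → Fin k) m u)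
      {u | ((hanoiAutomaton k).schreierGraph w).edist v u ≤ (n : ℕ∞)} := by
    refine (placesOfRank_injOn _ _).comp Subtype.val_injective.injOn fun u hu s hs => ?_
    exact (hanoiGraph_edist_le_iff.1 hu).diskRank_lt (by simp [hj]) hn hs
  refine ⟨Set.Finite.of_injOn (Set.mapsTo_univ _ _) hinj Set.finite_univ, ?_⟩
  refine (Set.ncard_le_ncard_of_injOn _ (fun _ _ => Set.mem_univ _) hinj
    Set.finite_univ).trans ?_
  rw [Set.ncard_univ, Nat.card_eq_fintype_card]
  simp

theorem hanoiGraph_neighborSet_finite {j : ℕ} (hj : k = j + 2) {w : ℕ → Fin k}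
    (v : HanoiOrbit w) : (((hanoiAutomaton k).schreierGraph w).neighborSet v).Finite := by
  refine (hanoiGraph_ball_finite_and_ncard_le hj v (n := 1) (x := 1) (by norm_num)).1.subset ?_
  intro u hu
  exact (SimpleGraph.edist_eq_one_iff_adj.2 hu).le

/-- All rearrangements of the `gatherSize j x` smallest disks of `v` become the same position once
these disks are gathered on peg `0`. Gathering from `v` and undoing the gathering reaches each of
them. -/
theorem hanoiGraph_le_growthFunction {j : ℕ} (hj : k = j + 2) {w : ℕ → Fin k}
    (v : HanoiOrbit w) {n x : ℕ} (hn : 2 * 5 ^ x ≤ n) :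
    k ^ gatherSize j x ≤ growthFunction ((hanoiAutomaton k).schreierGraph w) v n := by
  set m := gatherSize j x
  have hk : 0 < k := by omega
  have hgather : ∀ u : ℕ → Fin k,
      HanoiReach (5 ^ x) u (gathered (Finset.range m) ⟨0, hk⟩ u) := fun u =>
    gather j x _ Finset.univ _ u (by simp [hj]) (by simp [m]) (Finset.mem_univ _)
      (fun _ _ => Finset.mem_univ _) fun d hd e hed he => by
        rw [Finset.mem_range] at hd he
        omega
  let f : (Fin m → Fin k) → ℕ → Fin k := fun φ d =>
    if h : d < m then φ ⟨d, h⟩ else (v : ℕ → Fin k) d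
  have hf : ∀ φ, HanoiReach n (v : ℕ → Fin k) (f φ) := by
    intro φ
    refine ((hgather v).trans (?_ : HanoiReach (5 ^ x) _ _)).mono (by omega : 5 ^ x + 5 ^ x ≤ n)
    have : gathered (Finset.range m) ⟨0, hk⟩ (v : ℕ → Fin k) =
        gathered (Finset.range m) ⟨0, hk⟩ (f φ) := by
      funext d
      by_cases hd : d < m <;> simp [gathered, f, hd]
    rw [this]
    exact (hgather _).symm
  choose g hg hd using fun φ => (hf φ).exists_edist_le v.2
  have hginj : Function.Injective g := by
    intro φ ψ h
    funext d
    have h1 : f φ d = f ψ d := by rw [← hg, ← hg, h]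
    simpa [f] using h1
  -- Finiteness of the ball is essential, as `ncard` of an infinite set is `0`; any `x` with `n < 2
  -- ^ x` provides it.
  have h1 := Set.ncard_le_ncard_of_injOn (s := Set.univ) g (fun φ _ => hd φ) hginj.injOn
    (hanoiGraph_ball_finite_and_ncard_le hj v (Nat.lt_two_pow_self (n := n))).1
  rw [Set.ncard_univ, Nat.card_eq_fintype_card] at h1
  simpa [growthFunction] using h1

theorem hanoiGraph_two_le_growthFunction {j : ℕ} (hj : k = j + 2) {w : ℕ → Fin k}
    (v : HanoiOrbit w) {n : ℕ} (hn : 1 ≤ n) :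
    2 ≤ growthFunction ((hanoiAutomaton k).schreierGraph w) v n := by
  have : Nontrivial (Fin k) := Fin.nontrivial_iff_two_le.2 (by omega)
  obtain ⟨p, hp⟩ := exists_ne ((v : ℕ → Fin k) 0)
  have h := (HanoiReach.of_step (gather_of_card_le_one (D := {0}) (P := Finset.univ) (p := p)
    (u := (v : ℕ → Fin k)) (by simp) (by simp) (by simp) (by simp))).mono hn
  obtain ⟨u, hu, hd⟩ := h.exists_edist_le v.2
  have hne : v ≠ u := by
    rintro rfl
    have := congrFun hu 0
    simp only [gathered, Finset.mem_singleton, if_true] at this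
    exact hp this.symm
  rw [← Set.ncard_pair hne]
  refine Set.ncard_le_ncard ?_
    (hanoiGraph_ball_finite_and_ncard_le hj v (Nat.lt_two_pow_self (n := n))).1
  rintro y (rfl | rfl)
  · simp
  · exact hd

end Hanoi

/-! ### Logarithms and comparison of growth -/

theorem one_le_binLog (n : ℕ) : 1 ≤ binLog n := by
  unfold binLog
  split_ifs with h
  · exact le_rfl
  · rw [Real.le_logb_iff_rpow_le (by norm_num) (Nat.cast_pos.2 (by omega)), Real.rpow_one]
    exact_mod_cast (not_le.1 h)

theorem binLog_mono : Monotone binLog := by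
  intro m n hmn
  by_cases hm : m ≤ 1
  · rw [binLog, if_pos hm]
    exact one_le_binLog n
  · rw [binLog, binLog, if_neg hm, if_neg (by omega)]
    exact Real.logb_le_logb_of_le (by norm_num) (Nat.cast_pos.2 (by omega)) (by exact_mod_cast hmn)

theorem binLog_two_pow {t : ℕ} (ht : 1 ≤ t) : binLog (2 ^ t) = t := by
  have : 2 ≤ 2 ^ t := Nat.le_self_pow (by omega) 2
  rw [binLog, if_neg (by omega)]
  push_cast
  rw [Real.logb_pow, Real.logb_self_eq_one (by norm_num), mul_one]

theorem natLog_le_binLog (n : ℕ) : (Nat.log 2 n : ℝ) ≤ binLog n := by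
  by_cases h : n ≤ 1
  · rw [Nat.log_of_lt (by omega), Nat.cast_zero]
    exact zero_le_one.trans (one_le_binLog n)
  · rw [binLog, if_neg h]
    exact Real.natLog_le_logb n 2

theorem logb_le_binLog (n : ℕ) : Real.logb 2 n ≤ binLog n := by
  unfold binLog
  split_ifs with h
  · interval_cases n <;> simp
  · exact le_rfl

theorem eventually_binLog_pow_le (j : ℕ) {ε : ℝ} (hε : 0 < ε) :
    ∃ N : ℕ, ∀ n ≥ N, binLog n ^ j ≤ ε * n := by
  have h2 : 0 < Real.log 2 := Real.log_pos (by norm_num)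
  have h := ((Real.isLittleO_pow_log_id_atTop (n := j)).comp_tendsto
    (tendsto_natCast_atTop_atTop (R := ℝ))).bound (c := ε * Real.log 2 ^ j) (by positivity)
  obtain ⟨N, hN⟩ := Filter.eventually_atTop.1 h
  refine ⟨max N 2, fun n hn => ?_⟩
  have h1 := hN n (le_of_max_le_left hn)
  have hn2 : 2 ≤ n := le_of_max_le_right hn
  have h3 : 0 ≤ Real.log n := Real.log_nonneg (by exact_mod_cast (by omega : 1 ≤ n))
  simp only [Function.comp_apply, id_eq, Real.norm_eq_abs] at h1
  rw [abs_of_nonneg (by positivity), abs_of_nonneg (by positivity)] at h1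
  rw [binLog, if_neg (by omega), Real.logb, div_pow, div_le_iff₀ (by positivity)]
  linarith

theorem exists_binLog_pow_le (j : ℕ) : ∃ B : ℝ, 0 < B ∧ ∀ n ≥ 1, binLog n ^ j ≤ B * n := by
  obtain ⟨N, hN⟩ := eventually_binLog_pow_le j one_pos
  have hB : 1 ≤ binLog N ^ j := one_le_pow₀ (one_le_binLog N)
  refine ⟨binLog N ^ j, by linarith, fun n hn => ?_⟩
  have hn' : (1 : ℝ) ≤ n := by exact_mod_cast hn
  rcases le_total N n with h | h
  · have := hN n h
    nlinarith
  · have := pow_le_pow_left₀ (zero_le_one.trans (one_le_binLog n)) (binLog_mono h) j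
    nlinarith

theorem exists_eval_le (p : Polynomial ℝ) :
    ∃ D : ℝ, 0 < D ∧ ∀ n : ℕ, 1 ≤ n → p.eval (n : ℝ) ≤ (2 : ℝ) ^ (D * binLog n) := by
  obtain ⟨a, ha⟩ := pow_unbounded_of_one_lt
    (∑ i ∈ Finset.range (p.natDegree + 1), |p.coeff i|) (one_lt_two : (1 : ℝ) < 2)
  refine ⟨a + p.natDegree + 1, by positivity, fun n hn => ?_⟩
  have hn' : (1 : ℝ) ≤ n := by exact_mod_cast hn
  have hL := one_le_binLog n
  have h1 : p.eval (n : ℝ) ≤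
      (∑ i ∈ Finset.range (p.natDegree + 1), |p.coeff i|) * (n : ℝ) ^ p.natDegree := by
    rw [Polynomial.eval_eq_sum_range, Finset.sum_mul]
    refine Finset.sum_le_sum fun i hi => ?_
    refine mul_le_mul (le_abs_self _) (pow_le_pow_right₀ hn' ?_) (by positivity) (abs_nonneg _)
    have := Finset.mem_range.1 hi
    omega
  have h2 : (n : ℝ) ≤ 2 ^ binLog n := by
    rw [← Real.logb_le_iff_le_rpow (by norm_num) (by linarith)]
    exact logb_le_binLog n
  calc p.eval (n : ℝ) ≤ 2 ^ a * ((2 : ℝ) ^ binLog n) ^ p.natDegree :=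
        h1.trans (mul_le_mul ha.le (pow_le_pow_left₀ (by positivity) h2 _) (by positivity)
          (by positivity))
    _ = (2 : ℝ) ^ (a + binLog n * p.natDegree) := by
        rw [Real.rpow_add (by norm_num), Real.rpow_natCast, Real.rpow_mul (by norm_num),
          Real.rpow_natCast]
    _ ≤ _ := by
        refine Real.rpow_le_rpow_of_exponent_le (by norm_num) ?_
        have : (a : ℝ) ≤ a * binLog n := le_mul_of_one_le_right (by positivity) hL
        nlinarith

theorem isSuperpolynomial_of_le {f : ℕ → ℝ} {c : ℝ} (hc : 0 < c)
    (hf : ∀ n, 1 ≤ n → (2 : ℝ) ^ (c * binLog n ^ 2) ≤ f n) : IsSuperpolynomial f := by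
  intro p
  obtain ⟨D, hD, hp⟩ := exists_eval_le p
  constructor
  -- Scaling by `2 ^ t` makes one of the two logarithmic factors at least `t ≥ D / c`.
  · obtain ⟨t, ht⟩ := exists_nat_ge (D / c + 1)
    have ht1 : (1 : ℝ) ≤ t := by
      have : 0 < D / c := by positivity
      linarith
    have ht' : D ≤ c * t := by
      have h := (div_le_iff₀' hc).1 (show D / c ≤ t by linarith)
      exact h
    refine ⟨2 ^ t, by positivity, fun n hn => (hp n hn).trans ?_⟩
    have hpos : 0 < 2 ^ t := by positivity
    refine le_trans ?_ (hf _ (Nat.mul_pos hpos hn))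
    refine Real.rpow_le_rpow_of_exponent_le (by norm_num) ?_
    have h1 : (t : ℝ) ≤ binLog (2 ^ t * n) := by
      rw [← binLog_two_pow (by exact_mod_cast ht1)]
      exact binLog_mono (Nat.le_mul_of_pos_right _ hn)
    have h2 : binLog n ≤ binLog (2 ^ t * n) := binLog_mono (Nat.le_mul_of_pos_left _ hpos)
    have h3 := one_le_binLog n
    have h4 := h3.trans h2
    calc D * binLog n ≤ c * t * binLog n := by gcongr
      _ = c * (t * binLog n) := by ring
      _ ≤ c * (binLog (2 ^ t * n) * binLog (2 ^ t * n)) := by gcongr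
      _ = _ := by ring
  · rintro ⟨C, hC, hle⟩
    -- At `n = 2 ^ t` the assumption gives `c * t ^ 2 ≤ D * (2 * t)`, since `C ≤ 2 ^ t`; but `c * t
    -- > 2 * D`.
    obtain ⟨t, ht⟩ := exists_nat_gt (C + 2 * D / c + 1)
    have hq : 0 < 2 * D / c := by positivity
    have hC' : (0 : ℝ) ≤ C := by positivity
    have ht1 : 1 ≤ t := by exact_mod_cast (by linarith : (1 : ℝ) ≤ t)
    have htC : (C : ℝ) ≤ t := by linarith
    have h1 := (hf (2 ^ t) (Nat.one_le_two_pow)).trans ((hle _ Nat.one_le_two_pow).trans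
      (hp _ (Nat.mul_pos hC (by positivity))))
    rw [Real.rpow_le_rpow_left_iff (by norm_num), binLog_two_pow ht1] at h1
    have h2 : binLog (C * 2 ^ t) ≤ (2 * t : ℕ) := by
      rw [← binLog_two_pow (by omega)]
      refine binLog_mono ?_
      rw [two_mul, pow_add]
      refine Nat.mul_le_mul_right _ (le_trans ?_ (Nat.lt_two_pow_self (n := t)).le)
      exact_mod_cast htC
    push_cast at h2
    have h3 : 2 * D < c * t := (div_lt_iff₀' hc).1 (by linarith)
    have h4 : (0 : ℝ) < t := by exact_mod_cast ht1
    have h5 : D * binLog (C * 2 ^ t) ≤ D * (2 * t) := by gcongr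
    nlinarith

theorem isSubexponential_of_le {f : ℕ → ℝ} {E : ℝ} (hE : 0 < E) (j : ℕ)
    (hf : ∀ n, f n ≤ (2 : ℝ) ^ (E * binLog n ^ j)) : IsSubexponential f := by
  intro a ha
  have hl : 0 < Real.logb 2 a := Real.logb_pos (by norm_num) ha
  have hpow : ∀ n : ℕ, a ^ n = (2 : ℝ) ^ (Real.logb 2 a * n) := by
    intro n
    rw [Real.rpow_mul (by norm_num), Real.rpow_logb (by norm_num) (by norm_num) (by linarith),
      Real.rpow_natCast]
  constructor
  · obtain ⟨B, hB, hBn⟩ := exists_binLog_pow_le j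
    obtain ⟨C, hC⟩ := exists_nat_gt (E * B / Real.logb 2 a)
    have hC0 : (0 : ℝ) < C := lt_trans (by positivity) hC
    refine ⟨C, by exact_mod_cast hC0, fun n hn => (hf n).trans ?_⟩
    simp only [hpow]
    refine Real.rpow_le_rpow_of_exponent_le (by norm_num) ?_
    rw [div_lt_iff₀' hl] at hC
    push_cast
    calc E * binLog n ^ j ≤ E * (B * n) := by gcongr; exact hBn n hn
      _ = E * B * n := by ring
      _ ≤ Real.logb 2 a * C * n := by gcongr
      _ = _ := by ring
  · rintro ⟨C, hC, hle⟩
    have hC' : (0 : ℝ) < C := by exact_mod_cast hC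
    -- This `ε` bounds the exponent of `f (C * n)` by half the exponent of `a ^ n`.
    obtain ⟨N, hN⟩ := eventually_binLog_pow_le j
      (show 0 < Real.logb 2 a / (2 * E * C) by positivity)
    have h1 := (hle (N + 1) (by omega)).trans (hf _)
    simp only [hpow] at h1
    rw [Real.rpow_le_rpow_left_iff (by norm_num)] at h1
    have h2 := hN (C * (N + 1)) ((Nat.le_succ N).trans (Nat.le_mul_of_pos_left _ hC))
    have h3 : E * binLog (C * (N + 1)) ^ j ≤
        E * (Real.logb 2 a / (2 * E * C) * (C * (N + 1) : ℕ)) := by gcongr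
    have h4 : E * (Real.logb 2 a / (2 * E * C) * (C * (N + 1) : ℕ)) =
        Real.logb 2 a * ((N + 1 : ℕ) : ℝ) / 2 := by
      push_cast
      field_simp
    have h5 : 0 < Real.logb 2 a * ((N + 1 : ℕ) : ℝ) := by positivity
    linarith

/-! ### The growth bounds and intermediate growth -/

theorem hanoiGraph_exists_upper_bound {k j : ℕ} (hj : k = j + 2) :
    ∃ C : ℝ, 0 < C ∧ ∀ (w : ℕ → Fin k) (v : HanoiOrbit w) (n : ℕ),
      (growthFunction ((hanoiAutomaton k).schreierGraph w) v n : ℝ) ≤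
        (k : ℝ) ^ (C * binLog n ^ j) := by
  have hk : (1 : ℝ) ≤ k := by exact_mod_cast (by omega : 1 ≤ k)
  -- With `x = Nat.log 2 n + 1` one has `x + 1 ≤ 3 * binLog n`; this `3` and the base `3` of the
  -- disk count make `9`.
  refine ⟨k * 9 ^ j, by positivity, fun w v n => ?_⟩
  have h1 := (hanoiGraph_ball_finite_and_ncard_le hj v
    (Nat.lt_pow_succ_log_self one_lt_two n)).2
  have h2 : (growthFunction ((hanoiAutomaton k).schreierGraph w) v n : ℝ) ≤
      (k : ℝ) ^ (k * (3 ^ j * (Nat.log 2 n + 1 + 1) ^ j)) := by exact_mod_cast h1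
  refine h2.trans ?_
  rw [← Real.rpow_natCast]
  refine Real.rpow_le_rpow_of_exponent_le hk ?_
  push_cast
  have h3 := natLog_le_binLog n
  have h4 := one_le_binLog n
  have h5 : ((Nat.log 2 n : ℝ) + 1 + 1) ^ j ≤ (3 * binLog n) ^ j :=
    pow_le_pow_left₀ (by positivity) (by linarith) j
  calc (k : ℝ) * (3 ^ j * ((Nat.log 2 n : ℝ) + 1 + 1) ^ j)
      ≤ k * (3 ^ j * (3 * binLog n) ^ j) := by gcongr
    _ = k * 9 ^ j * binLog n ^ j := by
      rw [mul_pow, show (9 : ℝ) = 3 * 3 by norm_num, mul_pow]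
      ring

theorem hanoiGraph_exists_lower_bound {k j : ℕ} (hj : k = j + 2) :
    ∃ c : ℝ, 0 < c ∧ ∀ (w : ℕ → Fin k) (v : HanoiOrbit w) (n : ℕ), 1 ≤ n →
      (k : ℝ) ^ (c * binLog n ^ j) ≤
        (growthFunction ((hanoiAutomaton k).schreierGraph w) v n : ℝ) := by
  have hk : (1 : ℝ) ≤ k := by exact_mod_cast (by omega : 1 ≤ k)
  obtain ⟨K, hK, hKx⟩ := exists_pow_le_gatherSize j
  have hK' : (0 : ℝ) < K := by exact_mod_cast hK
  -- The bound `1 / k` serves `n = 1`, where no gathering fits and only `k ^ (1 / k) ≤ 2` is used.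
  -- The `4` comes from `n ≤ 2 * 8 ^ (x + 1) ≤ 2 ^ (4 * (x + 1))`.
  refine ⟨min (1 / (4 ^ j * K)) (1 / k), by positivity, fun w v n hn => ?_⟩
  rcases Nat.lt_or_ge n 2 with hn2 | hn2
  · have h1 := hanoiGraph_two_le_growthFunction hj v hn
    have h2 : (2 : ℝ) ≤ growthFunction ((hanoiAutomaton k).schreierGraph w) v n := by
      exact_mod_cast h1
    refine le_trans ?_ h2
    rw [binLog, if_pos (by omega), one_pow, mul_one]
    refine (Real.rpow_le_rpow_of_exponent_le hk (min_le_right _ _)).trans ?_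
    rw [one_div, Real.rpow_inv_le_iff_of_pos (by linarith) (by norm_num) (by linarith),
      Real.rpow_natCast]
    exact_mod_cast (Nat.lt_two_pow_self (n := k)).le
  · obtain ⟨x, hx⟩ : ∃ x, x = Nat.log 5 (n / 2) := ⟨_, rfl⟩
    have h1 : 2 * 5 ^ x ≤ n := by
      have := Nat.pow_log_le_self 5 (show n / 2 ≠ 0 by omega)
      rw [← hx] at this
      omega
    have h2 : n ≤ 2 ^ (4 * (x + 1)) := by
      have h3 : n / 2 < 5 ^ (x + 1) :=
        hx ▸ Nat.lt_pow_succ_log_self (by norm_num) _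
      have h4 : 5 ^ (x + 1) ≤ 2 ^ (3 * (x + 1)) := by
        rw [pow_mul]
        exact Nat.pow_le_pow_left (by norm_num) _
      have h5 : 2 ^ (3 * (x + 1) + 1) ≤ 2 ^ (4 * (x + 1)) :=
        Nat.pow_le_pow_right (by norm_num) (by omega)
      rw [pow_succ] at h5
      omega
    have h3 : binLog n ≤ 4 * ((x : ℝ) + 1) := by
      have := binLog_mono h2
      rw [binLog_two_pow (by omega)] at this
      exact_mod_cast this
    have h4 : binLog n ^ j ≤ 4 ^ j * (K * gatherSize j x) := by
      calc binLog n ^ j ≤ (4 * ((x : ℝ) + 1)) ^ j :=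
            pow_le_pow_left₀ (zero_le_one.trans (one_le_binLog n)) h3 j
        _ = 4 ^ j * ((x : ℝ) + 1) ^ j := mul_pow _ _ _
        _ ≤ 4 ^ j * (K * gatherSize j x) := by
          refine mul_le_mul_of_nonneg_left ?_ (by positivity)
          exact_mod_cast hKx x
    have h5 : (k : ℝ) ^ gatherSize j x ≤
        growthFunction ((hanoiAutomaton k).schreierGraph w) v n := by
      exact_mod_cast hanoiGraph_le_growthFunction hj v h1
    refine le_trans ?_ h5
    rw [← Real.rpow_natCast (k : ℝ) (gatherSize j x)]
    refine Real.rpow_le_rpow_of_exponent_le hk ?_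
    have h6 : 0 ≤ binLog n ^ j := pow_nonneg (zero_le_one.trans (one_le_binLog n)) j
    refine (mul_le_mul_of_nonneg_right (min_le_left _ _) h6).trans ?_
    rw [one_div, inv_mul_le_iff₀ (by positivity)]
    linarith

theorem hanoiGraph_hasIntermediateGrowth {k : ℕ} (hk : 4 ≤ k) (w : ℕ → Fin k) :
    HasIntermediateGrowth ((hanoiAutomaton k).schreierGraph w) := by
  obtain ⟨j, hj⟩ : ∃ j, k = j + 2 := ⟨k - 2, by omega⟩
  have hk2 : (2 : ℝ) ≤ k := by exact_mod_cast (by omega : 2 ≤ k)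
  refine ⟨hanoiGraph_connected w, hanoiGraph_neighborSet_finite hj, fun v => ?_, fun v => ?_⟩
  · obtain ⟨c, hc, h⟩ := hanoiGraph_exists_lower_bound hj
    refine isSuperpolynomial_of_le hc fun n hn => le_trans ?_ (h w v n hn)
    -- The hypothesis `4 ≤ k` enters here, as `2 ≤ j`.
    have h1 : binLog n ^ 2 ≤ binLog n ^ j := pow_le_pow_right₀ (one_le_binLog n) (by omega)
    have h2 : 0 ≤ c * binLog n ^ j :=
      mul_nonneg hc.le (pow_nonneg (zero_le_one.trans (one_le_binLog n)) j)
    refine (Real.rpow_le_rpow_of_exponent_le (by norm_num) ?_).trans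
      (Real.rpow_le_rpow (by norm_num) hk2 h2)
    gcongr
  · obtain ⟨C, hC, h⟩ := hanoiGraph_exists_upper_bound hj
    refine isSubexponential_of_le (E := k * C) (by positivity) j fun n => (h w v n).trans ?_
    have h2 : 0 ≤ C * binLog n ^ j :=
      mul_nonneg hC.le (pow_nonneg (zero_le_one.trans (one_le_binLog n)) j)
    rw [mul_assoc, Real.rpow_mul (x := 2) (by norm_num), Real.rpow_natCast]
    refine Real.rpow_le_rpow (by positivity) ?_ h2
    exact_mod_cast (Nat.lt_two_pow_self (n := k)).le

end AutomatonGrowth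

theorem mainTheorem4 (k : ℕ) (hk : 4 ≤ k) :
    (∀ w : ℕ → Fin k,
      AutomatonGrowth.HasIntermediateGrowth
        ((AutomatonGrowth.hanoiAutomaton k).schreierGraph w)) ∧
    (∃ C : ℝ, 0 < C ∧ ∀ (w : ℕ → Fin k)
      (v : MulAction.orbit
        (Subgroup.closure (Set.range (AutomatonGrowth.hanoiAutomaton k).toPerm)) w) (n : ℕ),
        (AutomatonGrowth.growthFunction
          ((AutomatonGrowth.hanoiAutomaton k).schreierGraph w) v n : ℝ)
          ≤ (k : ℝ) ^ (C * AutomatonGrowth.binLog n ^ (k - 2))) ∧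
    (∃ c : ℝ, 0 < c ∧ ∀ (w : ℕ → Fin k)
      (v : MulAction.orbit
        (Subgroup.closure (Set.range (AutomatonGrowth.hanoiAutomaton k).toPerm)) w) (n : ℕ),
        1 ≤ n →
        (k : ℝ) ^ (c * AutomatonGrowth.binLog n ^ (k - 2))
          ≤ (AutomatonGrowth.growthFunction
              ((AutomatonGrowth.hanoiAutomaton k).schreierGraph w) v n : ℝ)) :=
  have hj : k = k - 2 + 2 := by omega
  ⟨AutomatonGrowth.hanoiGraph_hasIntermediateGrowth hk,
    AutomatonGrowth.hanoiGraph_exists_upper_bound hj,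
    AutomatonGrowth.hanoiGraph_exists_lower_bound hj⟩
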